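/- Let $G$ be a compact group, $L\ge 1$, and let $R^{(0)},\dots,R^{(L)}$ be continuous unitary representations of $G$ on finite-dimensional Hilbert spaces $\mathcal H_0,\dots,\mathcal H_L$ with fixed orthonormal bases. For each $j\in\{1,\dots,L\}$ fix a unitary isotypic decomposition $$\mathcal H_{j-1}\otimes\mathcal H_j\;\simeq\;\bigoplus_{\lambda}\mathbb C^{d_{j,\lambda}}\otimes\mathbb C^{m_{j,\lambda}}$$ of the representation $R^{(j-1)*}\otimes R^{(j)}$ (where $*$ is complex conjugation), with $\lambda$ running over the pairwise inequivalent irreducible representations that occur in it, $d_{j,\lambda}$ their dimensions and $m_{j,\lambda}\ge 1$ their multiplicities. For matrices $V_j=\{V_{j,\lambda}\}_\lambda$ with $V_{j,\lambda}\in\mathbb C^{m_{j,\lambda}\times m_{j,\lambda}}$, let $\phi_j^{V_j}:\mathcal B(\mathcal H_{j-1})\to\mathcal B(\mathcal H_j)$ be the (automatically $G$-equivariant) linear map whose Choi operator $\sum_{a,b}|a\rangle\langle b|\otimes\phi_j^{V_j}(|a\rangle\langle b|)$ is, in the basis adapted to this decomposition, $$\bigoplus_\lambda \mathbb I_{d_{j,\lambda}}\otimes\Big(\tfrac{1}{\dim\mathcal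 H_j}\mathbb I_{m_{j,\lambda}}+V_{j,\lambda}\Big).$$ Let $\{\Pi_k\}_{k=1}^K$ be the effects of a POVM on $\mathcal H_L$ and let $\rho(x)$, $x\in\mathcal X$, be density operators on $\mathcal H_0$. For parameters $w=\{W_{j,\lambda}\}_{j,\lambda}$ define the model output $$f_w(x)_k=\operatorname{Tr}\big(\Pi_k\,(\phi_L^{W_L}\circ\cdots\circ\phi_1^{W_1})(\rho(x))\big),\qquad k=1,\dots,K .$$ Let $\|\cdot\|_1$ be the trace norm and $\|V_j\|_{\mathrm{eq},1}=\sum_\lambda d_{j,\lambda}\|V_{j,\lambda}\|_1$. Let $w=\{W_{j,\lambda}\}$ be parameters for which every layer $\phi_j^{W_j}$ is a quantum channel (completely positive and trace preserving), and let $u=\{U_{j,\lambda}\}$ be a perturbation such that every perturbed layer $\phi_j^{W_j+U_j}$ is trace preserving (in particular, this holds if the perturbed layers are quantum channels) and $$\|U_{j,\lambda}\|_1\le\tfrac1L\|W_{j,\lambda}\|_1\qquad\text{for all } j,\lambda .$$ Then for every $x\in\mathcal X$, $$\max_{1\le k\le K}\big|f_{w+u}(x)_k-f_w(x)_k\big|\;\le\;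 e\sum_{j=1}^{L}\Big[\|U_j\|_{\mathrm{eq},1}\prod_{\ell=j+1}^{L}\|W_\ell\|_{\mathrm{eq},1}\Big].$$ -/

import Mathlib

open scoped Matrix Kronecker ComplexOrder

noncomputable section

namespace EquivariantQuantum

/-! ### Matrices, channels, measurements -/

/-- The trace norm `‖A‖₁ = Tr √(Aᴴ A)`, i.e. the sum of the singular values of `A`, which are the
square roots of the eigenvalues of `Aᴴ A`. -/
def traceNorm {n : Type*} [Fintype n] [DecidableEq n] (A : Matrix n n ℂ) : ℝ :=
  ∑ i, √((Matrix.isHermitian_conjTranspose_mul_self A).eigenvalues i)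

/-- A density operator: positive semidefinite of trace one. -/
def IsDensity {n : Type*} [Fintype n] (ρ : Matrix n n ℂ) : Prop :=
  ρ.PosSemidef ∧ ρ.trace = 1

/-- The effects `P 0, …, P (K - 1)` form a positive operator-valued measure. -/
def IsPOVM {n : Type*} [Fintype n] [DecidableEq n] {K : ℕ} (P : Fin K → Matrix n n ℂ) : Prop :=
  (∀ k, (P k).PosSemidef) ∧ ∑ k, P k = 1

/-- Trace preservation of a linear map between matrix algebras. -/
def IsTracePreserving {m n : Type*} [Fintype m] [Fintype n]
    (φ : Matrix m m ℂ →ₗ[ℂ] Matrix n n ℂ) : Prop :=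
  ∀ X, (φ X).trace = X.trace

open scoped Matrix.Norms.L2Operator MatrixOrder CStarAlgebra in
/-- A quantum channel: a completely positive and trace-preserving linear map. (Matrices carry the
operator norm and the positive-semidefinite order here.) -/
def IsChannel {m n : Type*} [Fintype m] [DecidableEq m] [Fintype n] [DecidableEq n]
    (φ : Matrix m m ℂ →ₗ[ℂ] Matrix n n ℂ) : Prop :=
  (∃ Φ : Matrix m m ℂ →CP Matrix n n ℂ, Φ.toLinearMap = φ) ∧ IsTracePreserving φ

/-- The linear map with (unnormalised) Choi operator `J` on `H_in ⊗ H_out`, so that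
`J = ∑ i j, |i⟩⟨j| ⊗ φ (|i⟩⟨j|)`. -/
def ofChoi {m n : Type*} [Fintype m] (J : Matrix (m × n) (m × n) ℂ) :
    Matrix m m ℂ →ₗ[ℂ] Matrix n n ℂ where
  toFun X := Matrix.of fun a b => ∑ i, ∑ j, X i j * J (i, a) (j, b)
  map_add' X Y := by
    ext a b
    simp [add_mul, Finset.sum_add_distrib]
  map_smul' c X := by
    ext a b
    simp [Finset.mul_sum, mul_assoc]

/-! ### Unitary representations and isotypic decompositions -/

/-- A (continuous) unitary representation of `G` on the Hilbert space `ℂ^ι`. -/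
abbrev UnitaryRep (G : Type*) [Group G] [TopologicalSpace G]
    (ι : Type*) [Fintype ι] [DecidableEq ι] :=
  G →ₜ* Matrix.unitaryGroup ι ℂ

namespace UnitaryRep

variable {G : Type*} [Group G] [TopologicalSpace G]
  {ι κ : Type*} [Fintype ι] [DecidableEq ι] [Fintype κ] [DecidableEq κ]

/-- The underlying linear representation on `ι → ℂ`. -/
def toRepresentation (π : UnitaryRep G ι) : Representation ℂ G (ι → ℂ) where
  toFun g := Matrix.toLin' (π g : Matrix ι ι ℂ)
  map_one' := by simp; rfl
  map_mul' g h := by simp [Matrix.toLin'_mul]; rfl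

/-- The representation `R* ⊗ S`, sending `g` to `conj (R g) ⊗ S g`. -/
def conjTensor (R : UnitaryRep G ι) (S : UnitaryRep G κ) : UnitaryRep G (ι × κ) where
  toFun g := ⟨(R g : Matrix ι ι ℂ).map star ⊗ₖ (S g : Matrix κ κ ℂ), by
    have hR : (R g : Matrix ι ι ℂ).map star * ((R g : Matrix ι ι ℂ).map star)ᴴ = 1 := by
      have h : (R g : Matrix ι ι ℂ) * (R g : Matrix ι ι ℂ)ᴴ = 1 :=
        Matrix.mem_unitaryGroup_iff.1 (R g).2
      have h2 : ((R g : Matrix ι ι ℂ).map star)ᴴ = (R g : Matrix ι ι ℂ)ᵀ := by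
        ext a b
        simp [Matrix.conjTranspose_apply]
      have h3 : (R g : Matrix ι ι ℂ).map star = ((R g : Matrix ι ι ℂ)ᴴ)ᵀ := rfl
      rw [h2, h3, ← Matrix.transpose_mul, h, Matrix.transpose_one]
    have hS : (S g : Matrix κ κ ℂ) * (S g : Matrix κ κ ℂ)ᴴ = 1 :=
      Matrix.mem_unitaryGroup_iff.1 (S g).2
    rw [Matrix.mem_unitaryGroup_iff, Matrix.star_eq_conjTranspose,
      Matrix.conjTranspose_kronecker, ← Matrix.mul_kronecker_mul, hR, hS,
      Matrix.one_kronecker_one]⟩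
  map_one' := by
    apply Subtype.ext
    simp
  map_mul' g h := by
    apply Subtype.ext
    simp [Matrix.mul_kronecker_mul]
  continuous_toFun := by
    refine Continuous.subtype_mk ?_ _
    refine continuous_matrix fun a b => ?_
    have h1 : Continuous fun g => (R g : Matrix ι ι ℂ) :=
      continuous_subtype_val.comp R.continuous_toFun
    have h2 : Continuous fun g => (S g : Matrix κ κ ℂ) :=
      continuous_subtype_val.comp S.continuous_toFun
    exact (continuous_star.comp (h1.matrix_elem a.1 b.1)).mul (h2.matrix_elem a.2 b.2)

end UnitaryRep

/-- An isotypic decomposition `ℂ^κ ≃ ⨁ λ, ℂ^(d λ) ⊗ ℂ^(m λ)` of a unitary representation `T`: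
finitely many pairwise inequivalent irreducible unitary representations `irrep λ` of dimensions
`dim λ`, positive multiplicities `mult λ`, and a unitary change of basis `basis` under which
`T g` becomes `⨁ λ, irrep λ g ⊗ 1`. -/
structure IsotypicDecomposition {G : Type*} [Group G] [TopologicalSpace G]
    {κ : Type*} [Fintype κ] [DecidableEq κ] (T : UnitaryRep G κ) where
  numIrreps : ℕ
  dim : Fin numIrreps → ℕ
  mult : Fin numIrreps → ℕ
  mult_pos : ∀ l, 0 < mult l
  irrep : ∀ l, UnitaryRep G (Fin (dim l))
  irreducible : ∀ l, (irrep l).toRepresentation.IsIrreducible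
  inequivalent : ∀ l l', l ≠ l' →
    IsEmpty ((irrep l).toRepresentation.Equiv (irrep l').toRepresentation)
  basis : Matrix ((l : Fin numIrreps) × (Fin (dim l) × Fin (mult l))) κ ℂ
  basis_mul_conjTranspose : basis * basisᴴ = 1
  conjTranspose_mul_basis : basisᴴ * basis = 1
  intertwines : ∀ g, basis * (T g : Matrix κ κ ℂ) * basisᴴ =
    Matrix.blockDiagonal' fun l =>
      (irrep l g : Matrix (Fin (dim l)) (Fin (dim l)) ℂ) ⊗ₖ
        (1 : Matrix (Fin (mult l)) (Fin (mult l)) ℂ)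

/-! ### Equivariant quantum models -/

/-- The architecture of an `L`-layer equivariant quantum model: unitary representations
`R⁽⁰⁾, …, R⁽ᴸ⁾` of `G` on `ℂ^(d 0), …, ℂ^(d L)` and, for the `j`-th layer (mapping level `j` to
level `j + 1`, `j = 0, …, L - 1`), an isotypic decomposition of `R⁽ʲ⁾* ⊗ R⁽ʲ⁺¹⁾`. -/
structure Architecture (G : Type*) [Group G] [TopologicalSpace G] (L : ℕ) where
  dim : Fin (L + 1) → ℕ
  rep : ∀ j, UnitaryRep G (Fin (dim j))
  iso : ∀ j : Fin L,
    IsotypicDecomposition (UnitaryRep.conjTensor (rep j.castSucc) (rep j.succ))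

namespace Architecture

variable {G : Type*} [Group G] [TopologicalSpace G] {L : ℕ} (A : Architecture G L)

/-- The parameters of layer `j`: one `m_λ × m_λ` matrix for each irrep `λ`. -/
abbrev LayerParams (j : Fin L) : Type :=
  ∀ l : Fin (A.iso j).numIrreps, Matrix (Fin ((A.iso j).mult l)) (Fin ((A.iso j).mult l)) ℂ

/-- The parameters `{W_{j,λ}}` of the whole model. -/
abbrev Params : Type :=
  ∀ j : Fin L, A.LayerParams j

/-- The Choi operator `⨁ λ, 1_{d_λ} ⊗ (1_{m_λ} / d_out + W_λ)` of layer `j`, written in the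
original basis of `H_in ⊗ H_out`. -/
def choi (j : Fin L) (W : A.LayerParams j) :
    Matrix (Fin (A.dim j.castSucc) × Fin (A.dim j.succ))
      (Fin (A.dim j.castSucc) × Fin (A.dim j.succ)) ℂ :=
  (A.iso j).basisᴴ *
    (Matrix.blockDiagonal' fun l =>
      (1 : Matrix (Fin ((A.iso j).dim l)) (Fin ((A.iso j).dim l)) ℂ) ⊗ₖ
        ((1 / (A.dim j.succ : ℂ)) • (1 : Matrix _ _ ℂ) + W l)) *
    (A.iso j).basis

/-- The linear map `φ_j` of layer `j` with parameters `W`. -/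
def layer (j : Fin L) (W : A.LayerParams j) :
    Matrix (Fin (A.dim j.castSucc)) (Fin (A.dim j.castSucc)) ℂ →ₗ[ℂ]
      Matrix (Fin (A.dim j.succ)) (Fin (A.dim j.succ)) ℂ :=
  ofChoi (A.choi j W)

/-- The operator obtained from `ρ` after the first `j` layers. -/
def state (w : A.Params) (ρ : Matrix (Fin (A.dim 0)) (Fin (A.dim 0)) ℂ) (j : Fin (L + 1)) :
    Matrix (Fin (A.dim j)) (Fin (A.dim j)) ℂ :=
  Fin.induction (motive := fun j => Matrix (Fin (A.dim j)) (Fin (A.dim j)) ℂ) ρ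
    (fun j X => A.layer j (w j) X) j

/-- The model output `f_w(x) k = Tr (Π_k (φ_L ∘ ⋯ ∘ φ_1) (ρ x))`. The values are real
(probabilities) whenever all layers are quantum channels; they are kept in `ℂ` so that no
information is discarded for parameters that do not preserve Hermiticity. -/
def output {𝒳 : Type*} {K : ℕ} (P : Fin K → Matrix (Fin (A.dim (Fin.last L)))
      (Fin (A.dim (Fin.last L))) ℂ)
    (ρ : 𝒳 → Matrix (Fin (A.dim 0)) (Fin (A.dim 0)) ℂ) (w : A.Params) (x : 𝒳) : Fin K → ℂ :=
  fun k => (P k * A.state w (ρ x) (Fin.last L)).trace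

/-- The equivariant 1-norm `∑ λ, d_λ ‖V_λ‖₁` of the parameters of a layer. -/
def eqNorm (j : Fin L) (V : A.LayerParams j) : ℝ :=
  ∑ l, ((A.iso j).dim l : ℝ) * traceNorm (V l)

end Architecture

end EquivariantQuantum

end

noncomputable section

namespace EquivariantQuantum

open scoped Matrix.Norms.L2Operator MatrixOrder CStarAlgebra

/-! ### Operator norm estimates -/

section OperatorNorm

variable {m n : Type*} [Fintype m] [Fintype n]

/-! A layer acts as `X ↦ Tr X • 1 / d_out + ofChoi (choiLinear V) X`, so on traceless operators only
the part linear in the parameters survives. Both networks preserve trace, hence the difference `X_j`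
of their states after `j` layers is traceless and satisfies `X_{j+1} = ofChoi (choiLinear (W + U))
X_j + ofChoi (choiLinear U) ρ_j`, with `ρ_j` the unperturbed state, a density operator. Duality
between operator and nuclear norm gives `nuclearNorm (ofChoi J X) ≤ nuclearNorm J * ‖X‖`
(`nuclearNorm_ofChoi_le`), and `choiLinear V` has nuclear norm at most `eqNorm V`. The errors
therefore obey an affine recursion with factors `(1 + 1/L) * eqNorm W` and sources `eqNorm U`,
starting from zero; unrolling it costs `(1 + 1/L) ^ L ≤ e`. Effects have operator norm at most one,
which carries the bound to the outputs. -/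

theorem norm_toLp_star (v : n → ℂ) : ‖WithLp.toLp 2 (star v)‖ = ‖WithLp.toLp 2 v‖ := by
  simp [EuclideanSpace.norm_eq]

variable [DecidableEq n]

theorem opNorm_le_of_forall {A : Matrix m n ℂ} {c : ℝ} (hc : 0 ≤ c)
    (h : ∀ v : n → ℂ, ‖WithLp.toLp 2 (A *ᵥ v)‖ ≤ c * ‖WithLp.toLp 2 v‖) : ‖A‖ ≤ c :=
  ContinuousLinearMap.opNorm_le_bound _ hc fun v => h v.ofLp

theorem norm_mulVec_le (A : Matrix m n ℂ) (v : n → ℂ) :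
    ‖WithLp.toLp 2 (A *ᵥ v)‖ ≤ ‖A‖ * ‖WithLp.toLp 2 v‖ :=
  Matrix.l2_opNorm_mulVec A (WithLp.toLp 2 v)

theorem opNorm_one_le : ‖(1 : Matrix n n ℂ)‖ ≤ 1 := by
  cases isEmpty_or_nonempty n
  · rw [Subsingleton.elim (1 : Matrix n n ℂ) 0, norm_zero]
    exact zero_le_one
  · exact CStarRing.norm_one.le

theorem opNorm_map_star_le (A : Matrix m n ℂ) : ‖A.map star‖ ≤ ‖A‖ := by
  refine opNorm_le_of_forall (norm_nonneg _) fun v => ?_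
  have h : A.map star *ᵥ v = star (A *ᵥ star v) := by
    ext i
    simp [Matrix.mulVec, dotProduct]
  rw [h, norm_toLp_star, ← norm_toLp_star v]
  exact norm_mulVec_le A _

theorem opNorm_vecMulVec_le (v : m → ℂ) (w : n → ℂ) :
    ‖Matrix.vecMulVec v (star w)‖ ≤ ‖WithLp.toLp 2 v‖ * ‖WithLp.toLp 2 w‖ := by
  refine opNorm_le_of_forall (by positivity) fun x => ?_
  have h : Matrix.vecMulVec v (star w) *ᵥ x = (star w ⬝ᵥ x) • v := by
    ext i
    simp [Matrix.mulVec, Matrix.vecMulVec, dotProduct, Finset.sum_mul]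
    exact Finset.sum_congr rfl fun j _ => by ring
  have h2 : star w ⬝ᵥ x = inner ℂ (WithLp.toLp 2 w) (WithLp.toLp 2 x) := by
    simp [EuclideanSpace.inner_eq_star_dotProduct, dotProduct_comm]
  rw [h, WithLp.toLp_smul, norm_smul, h2]
  nlinarith [norm_inner_le_norm (𝕜 := ℂ) (WithLp.toLp 2 w) (WithLp.toLp 2 x),
    norm_nonneg (WithLp.toLp 2 v)]

variable [DecidableEq m]

theorem opNorm_transpose_le (A : Matrix m n ℂ) : ‖Aᵀ‖ ≤ ‖A‖ := by
  have h : Aᵀ = Aᴴ.map star := by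
    ext i j
    simp
  rw [h, ← Matrix.l2_opNorm_conjTranspose A]
  exact opNorm_map_star_le _

theorem opNorm_le_one_of_mul_conjTranspose {P : Matrix m n ℂ} (h : P * Pᴴ = 1) : ‖P‖ ≤ 1 := by
  have h1 := Matrix.l2_opNorm_conjTranspose_mul_self Pᴴ
  rw [Matrix.conjTranspose_conjTranspose, h, Matrix.l2_opNorm_conjTranspose] at h1
  nlinarith [opNorm_one_le (n := m), norm_nonneg P]

theorem opNorm_compression_le {P : Matrix m n ℂ} (h : P * Pᴴ = 1) (B : Matrix n n ℂ) :
    ‖P * B * Pᴴ‖ ≤ ‖B‖ := by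
  have hP := opNorm_le_one_of_mul_conjTranspose h
  calc ‖P * B * Pᴴ‖ ≤ ‖P * B‖ * ‖Pᴴ‖ := Matrix.l2_opNorm_mul _ _
    _ ≤ (‖P‖ * ‖B‖) * ‖P‖ := by
      rw [Matrix.l2_opNorm_conjTranspose]
      gcongr
      exact Matrix.l2_opNorm_mul _ _
    _ ≤ (1 * ‖B‖) * 1 := by gcongr
    _ = ‖B‖ := by ring

/-- Selecting rows and columns along `f` is compression by a coisometry made of rows of the
identity. -/
theorem opNorm_submatrix_le (B : Matrix n n ℂ) {f : m → n} (hf : Function.Injective f) :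
    ‖B.submatrix f f‖ ≤ ‖B‖ := by
  have h1 : ((1 : Matrix n n ℂ).submatrix f id) * ((1 : Matrix n n ℂ).submatrix f id)ᴴ = 1 := by
    ext i j
    simp [Matrix.mul_apply, Matrix.one_apply, hf.eq_iff, eq_comm]
  have h2 : B.submatrix f f =
      ((1 : Matrix n n ℂ).submatrix f id) * B * ((1 : Matrix n n ℂ).submatrix f id)ᴴ := by
    ext i j
    simp [Matrix.mul_apply, Matrix.one_apply]
  rw [h2]
  exact opNorm_compression_le h1 B

/-- Star homomorphisms between C⋆-algebras are contractive, and `B ↦ 1 ⊗ B` is one. -/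
theorem opNorm_one_kronecker_le (B : Matrix n n ℂ) : ‖(1 : Matrix m m ℂ) ⊗ₖ B‖ ≤ ‖B‖ := by
  let φ : Matrix n n ℂ →⋆ₙₐ[ℂ] Matrix (m × n) (m × n) ℂ :=
    { toFun := fun B => (1 : Matrix m m ℂ) ⊗ₖ B
      map_smul' := fun c B => Matrix.kronecker_smul c 1 B
      map_zero' := Matrix.kronecker_zero 1
      map_add' := Matrix.kronecker_add 1
      map_mul' := fun B C => by rw [← Matrix.mul_kronecker_mul, one_mul]
      map_star' := fun B => by
        simp [Matrix.star_eq_conjTranspose, Matrix.conjTranspose_kronecker] }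
  exact NonUnitalStarAlgHom.norm_apply_le φ B

theorem opNorm_kronecker_one_le (A : Matrix m m ℂ) : ‖A ⊗ₖ (1 : Matrix n n ℂ)‖ ≤ ‖A‖ := by
  let φ : Matrix m m ℂ →⋆ₙₐ[ℂ] Matrix (m × n) (m × n) ℂ :=
    { toFun := fun A => A ⊗ₖ (1 : Matrix n n ℂ)
      map_smul' := fun c A => Matrix.smul_kronecker c A 1
      map_zero' := Matrix.zero_kronecker 1
      map_add' := fun A B => Matrix.add_kronecker A B 1
      map_mul' := fun B C => by rw [← Matrix.mul_kronecker_mul, one_mul]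
      map_star' := fun B => by
        simp [Matrix.star_eq_conjTranspose, Matrix.conjTranspose_kronecker] }
  exact NonUnitalStarAlgHom.norm_apply_le φ A

theorem opNorm_kronecker_le (A : Matrix m m ℂ) (B : Matrix n n ℂ) :
    ‖A ⊗ₖ B‖ ≤ ‖A‖ * ‖B‖ := by
  have h : A ⊗ₖ B = (A ⊗ₖ (1 : Matrix n n ℂ)) * ((1 : Matrix m m ℂ) ⊗ₖ B) := by
    rw [← Matrix.mul_kronecker_mul, one_mul, mul_one]
  rw [h]
  exact (norm_mul_le _ _).trans (mul_le_mul (opNorm_kronecker_one_le A)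
    (opNorm_one_kronecker_le B) (norm_nonneg _) (norm_nonneg _))

theorem IsDensity.opNorm_le_one {ρ : Matrix n n ℂ} (h : IsDensity ρ) : ‖ρ‖ ≤ 1 := by
  have hρ := h.1.isHermitian
  have hsum : ∑ i, hρ.eigenvalues i = 1 := by
    have := hρ.trace_eq_sum_eigenvalues
    rw [h.2] at this
    exact Complex.ofReal_injective (by rw [Complex.ofReal_sum, Complex.ofReal_one]; exact this.symm)
  rw [hρ.spectral_theorem, Unitary.conjStarAlgAut_apply, ← Unitary.coe_star,
    CStarRing.norm_mul_coe_unitary, CStarRing.norm_coe_unitary_mul, Matrix.l2_opNorm_diagonal,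
    pi_norm_le_iff_of_nonneg zero_le_one]
  intro i
  have h0 := h.1.eigenvalues_nonneg
  simp only [Function.comp_apply, Complex.coe_algebraMap, Complex.norm_real, Real.norm_eq_abs,
    RCLike.ofReal]
  rw [abs_of_nonneg (h0 i), ← hsum]
  exact Finset.single_le_sum (fun j _ => h0 j) (Finset.mem_univ i)

theorem IsPOVM.opNorm_le_one {K : ℕ} {P : Fin K → Matrix n n ℂ} (h : IsPOVM P) (k : Fin K) :
    ‖P k‖ ≤ 1 := by
  have h0 : ∀ k, 0 ≤ P k := fun k => (h.1 k).nonneg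
  have h1 : P k ≤ 1 := h.2 ▸ Finset.single_le_sum (fun j _ => h0 j) (Finset.mem_univ k)
  exact (CStarAlgebra.norm_le_one_iff_of_nonneg (P k) (h0 k)).2 h1

theorem IsChannel.isDensity {φ : Matrix m m ℂ →ₗ[ℂ] Matrix n n ℂ} (hφ : IsChannel φ)
    {ρ : Matrix m m ℂ} (h : IsDensity ρ) : IsDensity (φ ρ) := by
  obtain ⟨⟨Φ, rfl⟩, htr⟩ := hφ
  refine ⟨Matrix.nonneg_iff_posSemidef.1 ?_, (htr ρ).trans h.2⟩
  exact map_nonneg Φ h.1.nonneg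

end OperatorNorm

/-! ### The nuclear norm -/

section NuclearNorm

variable {m n : Type*} [Fintype m] [DecidableEq m] [Fintype n] [DecidableEq n]

/-- The norm of `X` dual to the operator norm under the trace pairing `(B, X) ↦ Tr (B X)`. -/
def nuclearNorm (X : Matrix n n ℂ) : ℝ :=
  ‖LinearMap.toContinuousLinearMap (Matrix.traceLinearMap n ℂ ℂ ∘ₗ LinearMap.mulRight ℂ X)‖

theorem nuclearNorm_nonneg (X : Matrix n n ℂ) : 0 ≤ nuclearNorm X := norm_nonneg _

theorem norm_trace_mul_le (B X : Matrix n n ℂ) : ‖(B * X).trace‖ ≤ nuclearNorm X * ‖B‖ :=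
  ContinuousLinearMap.le_opNorm (LinearMap.toContinuousLinearMap
    (Matrix.traceLinearMap n ℂ ℂ ∘ₗ LinearMap.mulRight ℂ X)) B

theorem nuclearNorm_le {X : Matrix n n ℂ} {c : ℝ} (hc : 0 ≤ c)
    (h : ∀ B : Matrix n n ℂ, ‖(B * X).trace‖ ≤ c * ‖B‖) : nuclearNorm X ≤ c :=
  ContinuousLinearMap.opNorm_le_bound _ hc h

theorem nuclearNorm_add_le (X Y : Matrix n n ℂ) :
    nuclearNorm (X + Y) ≤ nuclearNorm X + nuclearNorm Y := by
  refine nuclearNorm_le (add_nonneg (nuclearNorm_nonneg X) (nuclearNorm_nonneg Y)) fun B => ?_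
  rw [mul_add, Matrix.trace_add, add_mul]
  exact (norm_add_le _ _).trans (add_le_add (norm_trace_mul_le B X) (norm_trace_mul_le B Y))

/-- Pairing `X` with the rank-one matrix `|v⟩⟨Xv|` produces `‖Xv‖²`; one factor `‖Xv‖` then cancels.
-/
theorem opNorm_le_nuclearNorm (X : Matrix n n ℂ) : ‖X‖ ≤ nuclearNorm X := by
  refine opNorm_le_of_forall (nuclearNorm_nonneg X) fun v => ?_
  set y := X *ᵥ v with hy
  have h1 : (Matrix.vecMulVec v (star y) * X).trace = ((‖WithLp.toLp 2 y‖ ^ 2 : ℝ) : ℂ) := by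
    rw [Matrix.trace_mul_comm, Matrix.mul_vecMulVec, Matrix.trace_vecMulVec, ← hy,
      EuclideanSpace.norm_sq_eq]
    simp [dotProduct, Complex.mul_conj, Complex.normSq_eq_norm_sq]
  have h2 := norm_trace_mul_le (Matrix.vecMulVec v (star y)) X
  rw [h1, Complex.norm_real, Real.norm_of_nonneg (sq_nonneg _)] at h2
  have h3 := h2.trans (mul_le_mul_of_nonneg_left (opNorm_vecMulVec_le v y) (nuclearNorm_nonneg X))
  rcases (norm_nonneg (WithLp.toLp 2 y)).eq_or_lt with h0 | h0
  · rw [← h0]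
    exact mul_nonneg (nuclearNorm_nonneg X) (norm_nonneg _)
  · refine le_of_mul_le_mul_right ?_ h0
    linarith

theorem traceNorm_nonneg (A : Matrix n n ℂ) : 0 ≤ traceNorm A :=
  Finset.sum_nonneg fun _ _ => Real.sqrt_nonneg _

/-- The trace of `B * A` is evaluated in an eigenbasis of `Aᴴ * A`, whose vectors `A` sends to
vectors of length the singular values. Only this half of the duality is needed: the triangle
inequality is taken from the nuclear norm. -/
theorem nuclearNorm_le_traceNorm (A : Matrix n n ℂ) : nuclearNorm A ≤ traceNorm A := by
  refine nuclearNorm_le (traceNorm_nonneg A) fun B => ?_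
  set hA := Matrix.isHermitian_conjTranspose_mul_self A
  set b := hA.eigenvectorBasis
  have hnorm : ∀ i, ‖WithLp.toLp 2 (A *ᵥ (b i).ofLp)‖ = √(hA.eigenvalues i) := fun i => by
    rw [hA.eigenvalues_eq, ← Matrix.mulVec_mulVec, Matrix.dotProduct_mulVec,
      Matrix.vecMul_conjTranspose, star_star, EuclideanSpace.norm_eq]
    congr 1
    simp [dotProduct, ← Complex.normSq_eq_conj_mul_self, Complex.normSq_eq_norm_sq, b,
      -Matrix.mulVec_mulVec]
    norm_cast
  have htrace : (B * A).trace =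
      ∑ i, inner ℂ (b i) (WithLp.toLp 2 (B *ᵥ (A *ᵥ (b i).ofLp))) := by
    have h := LinearMap.trace_eq_sum_inner (Matrix.toEuclideanLin (B * A)) b
    rw [Matrix.toEuclideanLin_eq_toLin_orthonormal, Matrix.trace_toLin_eq] at h
    rw [h, ← Matrix.toEuclideanLin_eq_toLin_orthonormal]
    simp only [Matrix.mulVec_mulVec]
    rfl
  rw [htrace, traceNorm, Finset.sum_mul]
  refine (norm_sum_le _ _).trans (Finset.sum_le_sum fun i _ => ?_)
  calc _ ≤ ‖b i‖ * ‖WithLp.toLp 2 (B *ᵥ (A *ᵥ (b i).ofLp))‖ := norm_inner_le_norm _ _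
    _ ≤ 1 * (‖B‖ * ‖WithLp.toLp 2 (A *ᵥ (b i).ofLp)‖) := by
      rw [b.norm_eq_one]
      gcongr
      exact norm_mulVec_le B _
    _ = _ := by rw [hnorm, one_mul, mul_comm]

theorem nuclearNorm_conj_le {P : Matrix m n ℂ} (h : P * Pᴴ = 1) (D : Matrix m m ℂ) :
    nuclearNorm (Pᴴ * D * P) ≤ nuclearNorm D := by
  refine nuclearNorm_le (nuclearNorm_nonneg D) fun B => ?_
  have h1 : (B * (Pᴴ * D * P)).trace = ((P * B * Pᴴ) * D).trace := by
    rw [← Matrix.mul_assoc, Matrix.trace_mul_comm]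
    simp only [Matrix.mul_assoc]
  rw [h1]
  exact (norm_trace_mul_le _ D).trans
    (mul_le_mul_of_nonneg_left (opNorm_compression_le h B) (nuclearNorm_nonneg D))

/-- The pairing sees only the diagonal blocks of `B`, `d l` of them against each `V l`, and each is
a principal submatrix of norm at most `‖B‖`. -/
theorem nuclearNorm_blockDiagonal_le {ι : Type*} [Fintype ι] [DecidableEq ι] {d k : ι → ℕ}
    (V : ∀ l, Matrix (Fin (k l)) (Fin (k l)) ℂ) :
    nuclearNorm (Matrix.blockDiagonal' fun l => (1 : Matrix (Fin (d l)) (Fin (d l)) ℂ) ⊗ₖ V l) ≤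
      ∑ l, (d l : ℝ) * nuclearNorm (V l) := by
  refine nuclearNorm_le (Finset.sum_nonneg fun l _ =>
    mul_nonneg (Nat.cast_nonneg _) (nuclearNorm_nonneg _)) fun B => ?_
  have h1 : (B * Matrix.blockDiagonal' fun l =>
      (1 : Matrix (Fin (d l)) (Fin (d l)) ℂ) ⊗ₖ V l).trace =
      ∑ l, ∑ a : Fin (d l), (B.submatrix (fun s : Fin (k l) => ⟨l, a, s⟩)
        (fun s : Fin (k l) => ⟨l, a, s⟩) * V l).trace := by
    simp only [Matrix.trace, Matrix.diag, Fintype.sum_sigma, Fintype.sum_prod_type]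
    refine Finset.sum_congr rfl fun l _ => Finset.sum_congr rfl fun a _ =>
      Finset.sum_congr rfl fun s _ => ?_
    rw [Matrix.mul_apply, Fintype.sum_sigma, Fintype.sum_eq_single l, Fintype.sum_prod_type,
      Fintype.sum_eq_single a]
    · simp [Matrix.mul_apply, Matrix.blockDiagonal'_apply_eq]
    · intro a' ha
      simp [Matrix.blockDiagonal'_apply_eq, ha]
    · intro l' hl
      simp [Matrix.blockDiagonal'_apply_ne _ _ _ hl]
  rw [h1, Finset.sum_mul]
  refine (norm_sum_le _ _).trans (Finset.sum_le_sum fun l _ => ?_)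
  refine (norm_sum_le _ _).trans ?_
  have h2 : ∀ a ∈ (Finset.univ : Finset (Fin (d l))),
      ‖(B.submatrix (fun s : Fin (k l) => ⟨l, a, s⟩)
        (fun s : Fin (k l) => ⟨l, a, s⟩) * V l).trace‖ ≤ nuclearNorm (V l) * ‖B‖ := fun a _ =>
    (norm_trace_mul_le _ _).trans (mul_le_mul_of_nonneg_left
      (opNorm_submatrix_le B fun s t h => by simpa using h) (nuclearNorm_nonneg _))
  refine (Finset.sum_le_card_nsmul _ _ _ h2).trans (le_of_eq ?_)
  simp [mul_assoc]

/-- Pairing the output with `B` equals pairing `J` with `Xᵀ ⊗ B`, whose operator norm is at most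
`‖X‖ * ‖B‖`. -/
theorem nuclearNorm_ofChoi_le (J : Matrix (m × n) (m × n) ℂ) (X : Matrix m m ℂ) :
    nuclearNorm (ofChoi J X) ≤ nuclearNorm J * ‖X‖ := by
  refine nuclearNorm_le (mul_nonneg (nuclearNorm_nonneg J) (norm_nonneg X)) fun B => ?_
  have h : (B * ofChoi J X).trace = ((Xᵀ ⊗ₖ B) * J).trace := by
    simp only [Matrix.trace, Matrix.diag, Matrix.mul_apply, Fintype.sum_prod_type, ofChoi,
      LinearMap.coe_mk, AddHom.coe_mk, Matrix.of_apply, Finset.mul_sum, Matrix.kronecker_apply,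
      Matrix.transpose_apply]
    rw [Finset.sum_comm (s := (Finset.univ : Finset m))]
    refine Finset.sum_congr rfl fun a _ => ?_
    rw [Finset.sum_comm (s := (Finset.univ : Finset n)),
      Finset.sum_comm (s := (Finset.univ : Finset m)) (t := (Finset.univ : Finset m))]
    refine Finset.sum_congr rfl fun i _ => ?_
    rw [Finset.sum_comm]
    exact Finset.sum_congr rfl fun j _ => Finset.sum_congr rfl fun b _ => by ring
  rw [h, mul_assoc]
  refine (norm_trace_mul_le _ J).trans (mul_le_mul_of_nonneg_left ?_ (nuclearNorm_nonneg J))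
  exact (opNorm_kronecker_le _ _).trans
    (mul_le_mul_of_nonneg_right (opNorm_transpose_le X) (norm_nonneg B))

end NuclearNorm

end EquivariantQuantum

end

noncomputable section

namespace EquivariantQuantum

open scoped Matrix.Norms.L2Operator

/-! ### Error propagation through the layers -/

/-- The first layer is peeled off and its bound becomes the initial value `a` for the rest. Every
term is charged the full `q ^ L`, although later sources meet fewer factors `q`. -/
theorem le_of_affine_recursion {q : ℝ} (hq : 1 ≤ q) {L : ℕ} (n : Fin (L + 1) → ℝ)
    (c ε : Fin L → ℝ) (hc : ∀ j, 0 ≤ c j) (hε : ∀ j, 0 ≤ ε j) {a : ℝ} (ha : 0 ≤ a)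
    (h0 : n 0 ≤ a) (hstep : ∀ j : Fin L, n j.succ ≤ q * c j * n j.castSucc + ε j) :
    n (Fin.last L) ≤ q ^ L * (a * ∏ j, c j + ∑ j, ε j * ∏ i ∈ Finset.Ioi j, c i) := by
  induction L generalizing a with
  | zero => simpa using h0
  | succ L ih =>
    have hq0 : 0 ≤ q := zero_le_one.trans hq
    have h1 : n 1 ≤ q * c 0 * a + ε 0 :=
      (hstep 0).trans (by gcongr; exacts [mul_nonneg hq0 (hc 0), h0])
    have h2 := ih (fun j => n j.succ) (fun j => c j.succ) (fun j => ε j.succ)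
      (fun j => hc _) (fun j => hε _) (a := q * c 0 * a + ε 0)
      (add_nonneg (mul_nonneg (mul_nonneg hq0 (hc 0)) ha) (hε 0)) h1 (fun j => hstep j.succ)
    refine h2.trans ?_
    rw [Fin.prod_univ_succ, Fin.sum_univ_succ, Fin.prod_Ioi_zero, pow_succ, mul_assoc (q ^ L)]
    simp only [Fin.prod_Ioi_succ]
    refine mul_le_mul_of_nonneg_left ?_ (pow_nonneg hq0 L)
    have hp : 0 ≤ ∏ j : Fin L, c j.succ := Finset.prod_nonneg fun j _ => hc _
    have hs : 0 ≤ ∑ j : Fin L, ε j.succ * ∏ i ∈ Finset.Ioi j, c i.succ :=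
      Finset.sum_nonneg fun j _ => mul_nonneg (hε _) (Finset.prod_nonneg fun i _ => hc _)
    -- The two sides differ by `q - 1` times the source terms.
    nlinarith [mul_nonneg (sub_nonneg.2 hq) hs, mul_nonneg (sub_nonneg.2 hq) (mul_nonneg (hε 0) hp)]

theorem one_add_inv_pow_le_exp_one (L : ℕ) : (1 + 1 / (L : ℝ)) ^ L ≤ Real.exp 1 := by
  rcases L.eq_zero_or_pos with rfl | hL
  · simp
  · calc (1 + 1 / (L : ℝ)) ^ L ≤ Real.exp (1 / (L : ℝ)) ^ L := by
          gcongr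
          rw [add_comm]
          exact Real.add_one_le_exp _
      _ = Real.exp 1 := by
          rw [← Real.exp_nat_mul, mul_one_div_cancel (by positivity)]

theorem ofChoi_add {m n : Type*} [Fintype m] (J J' : Matrix (m × n) (m × n) ℂ)
    (X : Matrix m m ℂ) : ofChoi (J + J') X = ofChoi J X + ofChoi J' X := by
  ext a b
  simp [ofChoi, mul_add, Finset.sum_add_distrib]

theorem ofChoi_smul_one {m n : Type*} [Fintype m] [DecidableEq m] [DecidableEq n] (c : ℂ)
    (X : Matrix m m ℂ) :
    ofChoi (c • (1 : Matrix (m × n) (m × n) ℂ)) X = (c * X.trace) • (1 : Matrix n n ℂ) := by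
  ext a b
  simp only [ofChoi, LinearMap.coe_mk, AddHom.coe_mk, Matrix.of_apply, Matrix.smul_apply,
    smul_eq_mul, Matrix.one_apply, Prod.mk.injEq, Matrix.trace, Matrix.diag]
  by_cases h : a = b
  · simp [h, Finset.mul_sum, mul_comm]
  · simp [h]

/-! ### Splitting a layer into a depolarizing part and a part linear in the parameters. -/

namespace Architecture

variable {G : Type*} [Group G] [TopologicalSpace G] {L : ℕ} (A : Architecture G L)

/-- The Choi operator `⨁ λ, 1_{d_λ} ⊗ V_λ` of the linear dependence of layer `j` on its
parameters, written in the original basis of `H_in ⊗ H_out`. -/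
def choiLinear (j : Fin L) (V : A.LayerParams j) :
    Matrix (Fin (A.dim j.castSucc) × Fin (A.dim j.succ))
      (Fin (A.dim j.castSucc) × Fin (A.dim j.succ)) ℂ :=
  (A.iso j).basisᴴ *
    (Matrix.blockDiagonal' fun l =>
      (1 : Matrix (Fin ((A.iso j).dim l)) (Fin ((A.iso j).dim l)) ℂ) ⊗ₖ V l) *
    (A.iso j).basis

theorem choiLinear_add (j : Fin L) (V V' : A.LayerParams j) :
    A.choiLinear j (V + V') = A.choiLinear j V + A.choiLinear j V' := by
  simp only [choiLinear, Pi.add_apply, Matrix.kronecker_add]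
  rw [← Matrix.add_mul, ← Matrix.mul_add, ← Matrix.blockDiagonal'_add]
  rfl

/-- The scalar part is unchanged by the unitary change of basis. -/
theorem choi_eq (j : Fin L) (V : A.LayerParams j) :
    A.choi j V = (1 / (A.dim j.succ : ℂ)) • 1 + A.choiLinear j V := by
  have h : (Matrix.blockDiagonal' fun l =>
      (1 : Matrix (Fin ((A.iso j).dim l)) (Fin ((A.iso j).dim l)) ℂ) ⊗ₖ
        ((1 / (A.dim j.succ : ℂ)) • (1 : Matrix (Fin ((A.iso j).mult l)) _ ℂ) + V l)) =
      (1 / (A.dim j.succ : ℂ)) • 1 + Matrix.blockDiagonal' fun l =>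
        (1 : Matrix (Fin ((A.iso j).dim l)) (Fin ((A.iso j).dim l)) ℂ) ⊗ₖ V l := by
    rw [← Matrix.blockDiagonal'_one, ← Matrix.blockDiagonal'_smul, ← Matrix.blockDiagonal'_add]
    congr 1
    funext l
    simp [Matrix.kronecker_add, Matrix.kronecker_smul]
  rw [choi, h, Matrix.mul_add, Matrix.add_mul, Matrix.mul_smul, Matrix.smul_mul, Matrix.mul_one,
    (A.iso j).conjTranspose_mul_basis, choiLinear]

theorem layer_add_apply (j : Fin L) (W U : A.LayerParams j) (X) :
    A.layer j (W + U) X = A.layer j W X + ofChoi (A.choiLinear j U) X := by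
  rw [layer, layer, choi_eq, choi_eq, choiLinear_add, ← add_assoc, ofChoi_add]

theorem layer_apply_of_trace_eq_zero (j : Fin L) (W : A.LayerParams j)
    {X : Matrix (Fin (A.dim j.castSucc)) (Fin (A.dim j.castSucc)) ℂ} (hX : X.trace = 0) :
    A.layer j W X = ofChoi (A.choiLinear j W) X := by
  rw [layer, choi_eq, ofChoi_add, ofChoi_smul_one, hX, mul_zero, zero_smul, zero_add]

theorem nuclearNorm_choiLinear_le (j : Fin L) (V : A.LayerParams j) :
    nuclearNorm (A.choiLinear j V) ≤ ∑ l, ((A.iso j).dim l : ℝ) * nuclearNorm (V l) :=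
  (nuclearNorm_conj_le (A.iso j).basis_mul_conjTranspose _).trans (nuclearNorm_blockDiagonal_le V)

theorem nuclearNorm_choiLinear_le_eqNorm (j : Fin L) (V : A.LayerParams j) :
    nuclearNorm (A.choiLinear j V) ≤ A.eqNorm j V :=
  (A.nuclearNorm_choiLinear_le j V).trans (Finset.sum_le_sum fun _ _ =>
    mul_le_mul_of_nonneg_left (nuclearNorm_le_traceNorm _) (Nat.cast_nonneg _))

/-- The triangle inequality is applied block by block, in the nuclear norm, before passing to the
trace norm. -/
theorem nuclearNorm_choiLinear_add_le (j : Fin L) (W U : A.LayerParams j) {r : ℝ}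
    (h : ∀ l, traceNorm (U l) ≤ r * traceNorm (W l)) :
    nuclearNorm (A.choiLinear j (W + U)) ≤ (1 + r) * A.eqNorm j W := by
  refine (A.nuclearNorm_choiLinear_le j _).trans ?_
  rw [eqNorm, Finset.mul_sum]
  refine Finset.sum_le_sum fun l _ => ?_
  rw [mul_left_comm]
  refine mul_le_mul_of_nonneg_left ?_ (Nat.cast_nonneg _)
  have h1 := nuclearNorm_add_le (W l) (U l)
  have h2 := nuclearNorm_le_traceNorm (W l)
  have h3 := nuclearNorm_le_traceNorm (U l)
  have h4 := h l
  rw [Pi.add_apply]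
  linarith

theorem eqNorm_nonneg (j : Fin L) (V : A.LayerParams j) : 0 ≤ A.eqNorm j V :=
  Finset.sum_nonneg fun _ _ => mul_nonneg (Nat.cast_nonneg _) (traceNorm_nonneg _)

section State

variable (w : A.Params) (ρ : Matrix (Fin (A.dim 0)) (Fin (A.dim 0)) ℂ)

theorem state_zero : A.state w ρ 0 = ρ := rfl

theorem state_succ (j : Fin L) :
    A.state w ρ j.succ = A.layer j (w j) (A.state w ρ j.castSucc) :=
  Fin.induction_succ _ _ _

variable {w ρ}

theorem isDensity_state (hw : ∀ j, IsChannel (A.layer j (w j))) (hρ : IsDensity ρ)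
    (j : Fin (L + 1)) : IsDensity (A.state w ρ j) := by
  induction j using Fin.induction with
  | zero => exact hρ
  | succ j ih =>
    rw [state_succ]
    exact (hw j).isDensity ih

theorem trace_state (hw : ∀ j, IsTracePreserving (A.layer j (w j))) (j : Fin (L + 1)) :
    (A.state w ρ j).trace = ρ.trace := by
  induction j using Fin.induction with
  | zero => rfl
  | succ j ih => rw [state_succ, hw j, ih]

end State

theorem nuclearNorm_state_sub_le {w u : A.Params} {ρ : Matrix (Fin (A.dim 0)) (Fin (A.dim 0)) ℂ}
    (hρ : IsDensity ρ) (hw : ∀ j, IsChannel (A.layer j (w j)))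
    (hwu : ∀ j, IsTracePreserving (A.layer j ((w + u) j))) {r : ℝ} (hr : 0 ≤ r)
    (hu : ∀ j l, traceNorm (u j l) ≤ r * traceNorm (w j l)) :
    nuclearNorm (A.state (w + u) ρ (Fin.last L) - A.state w ρ (Fin.last L)) ≤
      (1 + r) ^ L * ∑ j : Fin L, A.eqNorm j (u j) * ∏ i ∈ Finset.Ioi j, A.eqNorm i (w i) := by
  have h := le_of_affine_recursion (q := 1 + r) (by linarith) (a := 0)
    (fun j => nuclearNorm (A.state (w + u) ρ j - A.state w ρ j))
    (fun j => A.eqNorm j (w j)) (fun j => A.eqNorm j (u j))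
    (fun j => A.eqNorm_nonneg j _) (fun j => A.eqNorm_nonneg j _) le_rfl ?_ ?_
  · simpa only [zero_mul, zero_add] using h
  · refine nuclearNorm_le le_rfl fun B => ?_
    simp [state_zero]
  · intro j
    set X := A.state (w + u) ρ j.castSucc - A.state w ρ j.castSucc with hX
    have htr : X.trace = 0 := by
      rw [hX, Matrix.trace_sub, A.trace_state hwu, A.trace_state fun j => (hw j).2, sub_self]
    -- The perturbed layer acts on the error and the parameter change on the unperturbed state. This
    -- order keeps positivity requirements off the perturbed network.
    have hstep : A.state (w + u) ρ j.succ - A.state w ρ j.succ =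
        ofChoi (A.choiLinear j ((w + u) j)) X +
          ofChoi (A.choiLinear j (u j)) (A.state w ρ j.castSucc) := by
      rw [← A.layer_apply_of_trace_eq_zero j _ htr, hX, map_sub, state_succ, state_succ,
        Pi.add_apply, A.layer_add_apply j (w j) (u j) (A.state w ρ j.castSucc)]
      abel
    rw [hstep]
    refine (nuclearNorm_add_le _ _).trans (add_le_add ?_ ?_)
    -- Weakening `‖X‖` to the nuclear norm of `X` closes the recursion.
    · refine (nuclearNorm_ofChoi_le _ _).trans (mul_le_mul
        (A.nuclearNorm_choiLinear_add_le j _ _ (hu j)) (opNorm_le_nuclearNorm X) (norm_nonneg _)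
        (mul_nonneg (by linarith) (A.eqNorm_nonneg j _)))
    · calc _ ≤ nuclearNorm (A.choiLinear j (u j)) * ‖A.state w ρ j.castSucc‖ :=
            nuclearNorm_ofChoi_le _ _
        _ ≤ A.eqNorm j (u j) * 1 := mul_le_mul (A.nuclearNorm_choiLinear_le_eqNorm j _)
            (A.isDensity_state hw hρ _).opNorm_le_one (norm_nonneg _) (A.eqNorm_nonneg j _)
        _ = A.eqNorm j (u j) := mul_one _

end Architecture

end EquivariantQuantum

end

theorem mainTheorem7
    {G : Type*} [Group G] [TopologicalSpace G] [IsTopologicalGroup G] [CompactSpace G]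
    {L : ℕ} (hL : 0 < L) (A : EquivariantQuantum.Architecture G L)
    {K : ℕ} (P : Fin K → Matrix (Fin (A.dim (Fin.last L))) (Fin (A.dim (Fin.last L))) ℂ)
    (hP : EquivariantQuantum.IsPOVM P)
    {𝒳 : Type*} (ρ : 𝒳 → Matrix (Fin (A.dim 0)) (Fin (A.dim 0)) ℂ)
    (hρ : ∀ x, EquivariantQuantum.IsDensity (ρ x))
    (w u : A.Params)
    (hw : ∀ j, EquivariantQuantum.IsChannel (A.layer j (w j)))
    (hwu : ∀ j, EquivariantQuantum.IsTracePreserving (A.layer j ((w + u) j)))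
    (hu : ∀ j l, EquivariantQuantum.traceNorm (u j l) ≤
      (1 / (L : ℝ)) * EquivariantQuantum.traceNorm (w j l))
    (x : 𝒳) :
    ‖A.output P ρ (w + u) x - A.output P ρ w x‖ ≤
      Real.exp 1 * ∑ j : Fin L, A.eqNorm j (u j) * ∏ i ∈ Finset.Ioi j, A.eqNorm i (w i) := by
  have hsum : 0 ≤ ∑ j : Fin L, A.eqNorm j (u j) * ∏ i ∈ Finset.Ioi j, A.eqNorm i (w i) :=
    Finset.sum_nonneg fun j _ => mul_nonneg (A.eqNorm_nonneg j _)
      (Finset.prod_nonneg fun i _ => A.eqNorm_nonneg i _)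
  -- The norm on `Fin K → ℂ` is the sup norm, i.e. the maximum over outcomes.
  refine (pi_norm_le_iff_of_nonneg (mul_nonneg (Real.exp_nonneg 1) hsum)).2 fun k => ?_
  have hout : (A.output P ρ (w + u) x - A.output P ρ w x) k =
      (P k * (A.state (w + u) (ρ x) (Fin.last L) - A.state w (ρ x) (Fin.last L))).trace := by
    rw [Matrix.mul_sub, Matrix.trace_sub]
    rfl
  rw [hout]
  refine (EquivariantQuantum.norm_trace_mul_le _ _).trans
    ((mul_le_of_le_one_right (EquivariantQuantum.nuclearNorm_nonneg _)
      (hP.opNorm_le_one k)).trans ?_)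
  exact (A.nuclearNorm_state_sub_le (hρ x) hw hwu (by positivity) hu).trans
    (mul_le_mul_of_nonneg_right (EquivariantQuantum.one_add_inv_pow_le_exp_one L) hsum)
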